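/- For a permutation $\pi$ of $[n]=\{1,\dots,n\}$, a descent of $\pi$ is an index $1\le i\le n-1$ with $\pi(i)>\pi(i+1)$, and a descent $i$ is a crossing descent if $\pi(i)\ge i+1\ge \pi(i+1)$. Let $\mathsf{des}(\pi)$ and $\mathsf{xdes}(\pi)$ be the numbers of descents and of crossing descents of $\pi$, let $D_n$ be the set of derangements of $[n]$ (permutations without fixed points), and let $$F(t,s;u)=1+\sum_{n\ge 2}\Bigl(\sum_{\pi\in D_n}t^{\mathsf{des}(\pi)}s^{\mathsf{xdes}(\pi)}\Bigr)u^n ,$$ a formal power series in $u$ with coefficients in $\mathbb{Z}[s,t]$. Theorem. For each integer $m\ge 0$, the coefficient of $t^m$ in $F(t,s;u)$, which is a formal power series in $u$ with coefficients in $\mathbb{Z}[s]$, is a rational fraction in $s$ and $u$: there are polynomials $P,Q\in\mathbb{Z}[s,u]$ with $Q\ne 0$ such that $Q\cdot [t^m]F(t,s;u)=P$. -/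

import Mathlib

/-- The descents of a permutation `π` of `{0, …, n-1}`: the positions `i` with `i + 1 < n`
and `π i > π (i + 1)`. -/
def descentSet {n : ℕ} (π : Equiv.Perm (Fin n)) : Finset (Fin n) :=
  Finset.univ.filter fun i => ∃ h : (i : ℕ) + 1 < n, π ⟨(i : ℕ) + 1, h⟩ < π i

/-- The crossing descents of `π`: the descents `i` with `π i ≥ i + 1 ≥ π (i + 1)`.
This condition does not change when positions and values are both shifted by one, so it is the
same for permutations of `{0, …, n-1}` and of `{1, …, n}`. -/
def crossingDescentSet {n : ℕ} (π : Equiv.Perm (Fin n)) : Finset (Fin n) :=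
  (descentSet π).filter fun i =>
    ∃ h : (i : ℕ) + 1 < n, (i : ℕ) + 1 ≤ (π i : ℕ) ∧ (π ⟨(i : ℕ) + 1, h⟩ : ℕ) ≤ (i : ℕ) + 1

/-- The number of descents. -/
def des {n : ℕ} (π : Equiv.Perm (Fin n)) : ℕ := (descentSet π).card

/-- The number of crossing descents. -/
def xdes {n : ℕ} (π : Equiv.Perm (Fin n)) : ℕ := (crossingDescentSet π).card

/-- The polynomial `∑ t ^ des π * s ^ xdes π` over all derangements `π` of an `n`-element set.
It lies in `ℤ[s][t]`: the outer variable is `t`, the inner variable is `s`. -/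
noncomputable def desXdesPoly (n : ℕ) : Polynomial (Polynomial ℤ) :=
  ∑ π : derangements (Fin n),
    (Polynomial.X : Polynomial (Polynomial ℤ)) ^ des π.1 *
      Polynomial.C ((Polynomial.X : Polynomial ℤ) ^ xdes π.1)

/-- The generating function `F(t,s;u) = 1 + ∑_{n ≥ 2} (∑_π t ^ des π * s ^ xdes π) u ^ n`,
a power series in `u` with coefficients in `ℤ[s][t]`. -/
noncomputable def derangementGF : PowerSeries (Polynomial (Polynomial ℤ)) :=
  1 + PowerSeries.mk fun n => if 2 ≤ n then desXdesPoly n else 0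

/-- The coefficient of `t ^ m` in a power series `f` in `u` with coefficients in `ℤ[s][t]`;
it is a power series in `u` with coefficients in `ℤ[s]`. -/
noncomputable def coeffT (m : ℕ) (f : PowerSeries (Polynomial (Polynomial ℤ))) :
    PowerSeries (Polynomial ℤ) :=
  PowerSeries.mk fun n => (PowerSeries.coeff n f).coeff m

/-- A power series `f` in `u` with coefficients in `ℤ[s]` is a rational fraction in `s` and `u`
if `f = P / Q` for two polynomials `P` and `Q ≠ 0` in `ℤ[s][u] = ℤ[s, u]`. The equation is
written without division; it determines `f`, since `ℤ[s]⟦u⟧` is an integral domain. -/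
def IsRationalFraction (f : PowerSeries (Polynomial ℤ)) : Prop :=
  ∃ P Q : Polynomial (Polynomial ℤ), Q ≠ 0 ∧
    (Q : PowerSeries (Polynomial ℤ)) * f = (P : PowerSeries (Polynomial ℤ))

/-! Write n = N + 1. Expanding t^des over all sets S of gaps that contain the descents, with weight
t^|S| (1-t)^(N-|S|), replaces descents by cuttings of the positions into M + 1 = |S| + 1 nonempty
runs on which π increases (`pow_des_eq_sum`). Only M ≤ m reaches t^m, and the power of 1-t then
contributes, up to sign, a binomial coefficient of fixed lower index; such factors preserve
rationality (`IsRationalFraction.choose_mul`). It remains to treat `runXdesPoly` for a fixed number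
of runs.

On a run, π(i) - i is weakly increasing, and for a derangement it is never 0. So each run is a
segment below the diagonal followed by one above it, either possibly empty, and xdes depends only on
which segments are nonempty (`xdes_eq_crossings`). Inclusion-exclusion over the nonempty segments
leaves the count of segmentations with prescribed directions, empty segments allowed.

Give each value v the letter of the segment containing the position π⁻¹(v). A stable sort of this
word recovers π, and the directions become a condition on each letter separately
(`isTypedSegmentation_sort`). With L_j the row forms of a 0-1 matrix A, the words of content a are
counted by the coefficient of x^a in a product over j of L_j^(a_j) - x_j L_j^(a_j - 1), without
correction term when a_j = 0. The corrections only produce powers of u, and the sum of the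
coefficients of x^a in ∏ L_j^(a_j) has generating function 1/det(1 - uA), by MacMahon's master
theorem (`charpolyRev_mul_symTrace`). -/

/-! ### Traces of symmetric powers. -/

/-- The linear form `∑ l, A j l * X l` attached to row `j` of a matrix. -/
noncomputable def rowForm {σ R : Type*} [Fintype σ] [CommRing R] (A : Matrix σ σ R) (j : σ) :
    MvPolynomial σ R :=
  ∑ l, MvPolynomial.C (A j l) * MvPolynomial.X l

/-- The trace of the `n`-th symmetric power of a matrix, computed in the basis of monomials. -/
noncomputable def symTrace {σ R : Type*} [Fintype σ] [DecidableEq σ] [CommRing R]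
    (A : Matrix σ σ R) (n : ℕ) : R :=
  ∑ b ∈ Finset.finsuppAntidiag (Finset.univ : Finset σ) n,
    MvPolynomial.coeff b (∏ j, rowForm A j ^ b j)

section Trace

variable {σ R : Type*} [Fintype σ] [DecidableEq σ] [CommRing R]

omit [DecidableEq σ] in
theorem rowForm_isHomogeneous (A : Matrix σ σ R) (j : σ) : (rowForm A j).IsHomogeneous 1 := by
  refine MvPolynomial.IsHomogeneous.sum _ _ _ fun l _ => ?_
  simpa using (MvPolynomial.isHomogeneous_C σ (A j l)).mul (MvPolynomial.isHomogeneous_X R l)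

omit [DecidableEq σ] in
theorem prod_rowForm_isHomogeneous (A : Matrix σ σ R) (b : σ →₀ ℕ) :
    (∏ j, rowForm A j ^ b j).IsHomogeneous (∑ j, b j) := by
  refine MvPolynomial.IsHomogeneous.prod _ _ _ fun j _ => ?_
  simpa using (rowForm_isHomogeneous A j).pow (b j)

theorem mem_finsuppAntidiag_univ {n : ℕ} {b : σ →₀ ℕ} :
    b ∈ Finset.finsuppAntidiag (Finset.univ : Finset σ) n ↔ ∑ j, b j = n := by
  simp [Finset.mem_finsuppAntidiag]

theorem eq_sum_finsuppAntidiag {p : MvPolynomial σ R} {n : ℕ} (hp : p.IsHomogeneous n) :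
    p = ∑ c ∈ Finset.finsuppAntidiag (Finset.univ : Finset σ) n,
      MvPolynomial.monomial c (MvPolynomial.coeff c p) := by
  conv_lhs => rw [p.as_sum]
  refine Finset.sum_subset (fun c hc => ?_) fun c _ hc => ?_
  · rw [mem_finsuppAntidiag_univ]
    have := hp (MvPolynomial.mem_support_iff.1 hc)
    rw [Finsupp.weight_apply, Finsupp.sum_fintype _ _ (by simp)] at this
    simpa using this
  · rw [MvPolynomial.notMem_support_iff.1 hc, map_zero]

/-- The substitution of the row forms of a matrix for the variables. -/
noncomputable def rowSubst (A : Matrix σ σ R) : MvPolynomial σ R →ₐ[R] MvPolynomial σ R :=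
  MvPolynomial.aeval (rowForm A)

omit [DecidableEq σ] in
theorem rowSubst_monomial (A : Matrix σ σ R) (b : σ →₀ ℕ) (r : R) :
    rowSubst A (MvPolynomial.monomial b r) = MvPolynomial.C r * ∏ j, rowForm A j ^ b j := by
  rw [rowSubst, MvPolynomial.aeval_monomial, Finsupp.prod_fintype _ _ (by simp)]
  rfl

omit [DecidableEq σ] in
theorem rowSubst_rowForm (A B : Matrix σ σ R) (j : σ) :
    rowSubst A (rowForm B j) = rowForm (B * A) j := by
  simp only [rowForm, map_sum, map_mul, rowSubst, MvPolynomial.aeval_X, MvPolynomial.algHom_C,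
    MvPolynomial.algebraMap_eq, Matrix.mul_apply, Finset.mul_sum, Finset.sum_mul]
  rw [Finset.sum_comm]
  simp only [mul_assoc]

/-- Functoriality of the symmetric power: substituting the forms of `A` into those of `B` gives the
forms of `B * A`. The double sum is symmetric, which yields invariance under conjugation. -/
theorem symTrace_mul (A B : Matrix σ σ R) (n : ℕ) :
    symTrace (B * A) n =
      ∑ b ∈ Finset.finsuppAntidiag (Finset.univ : Finset σ) n,
        ∑ c ∈ Finset.finsuppAntidiag (Finset.univ : Finset σ) n,
          MvPolynomial.coeff c (∏ j, rowForm B j ^ b j) *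
            MvPolynomial.coeff b (∏ j, rowForm A j ^ c j) := by
  refine Finset.sum_congr rfl fun b hb => ?_
  have hB := prod_rowForm_isHomogeneous B b
  rw [mem_finsuppAntidiag_univ.1 hb] at hB
  have : ∏ j, rowForm (B * A) j ^ b j = rowSubst A (∏ j, rowForm B j ^ b j) := by
    simp [rowSubst_rowForm]
  rw [this, eq_sum_finsuppAntidiag hB, map_sum, MvPolynomial.coeff_sum]
  refine Finset.sum_congr rfl fun c _ => ?_
  rw [← eq_sum_finsuppAntidiag hB, rowSubst_monomial, MvPolynomial.coeff_C_mul]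

theorem symTrace_mul_comm (A B : Matrix σ σ R) (n : ℕ) :
    symTrace (B * A) n = symTrace (A * B) n := by
  rw [symTrace_mul, symTrace_mul, Finset.sum_comm]
  simp only [mul_comm]

theorem map_symTrace {S : Type*} [CommRing S] (f : R →+* S) (A : Matrix σ σ R) (n : ℕ) :
    f (symTrace A n) = symTrace (A.map f) n := by
  simp only [symTrace, map_sum, ← MvPolynomial.coeff_map, map_prod, map_pow]
  simp [rowForm]

end Trace

/-! ### Triangularisation and MacMahon's master theorem. -/

section Triangular

variable {R : Type*} [CommRing R]

theorem symTrace_zero {k : ℕ} (A : Matrix (Fin k) (Fin k) R) : symTrace A 0 = 1 := by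
  simp [symTrace]

/-- If the first row of `A` is `(c, 0, …, 0)`, the symmetric traces of `A` satisfy a recursion
over those of the remaining block. -/
theorem symTrace_succ_of_row_zero {k : ℕ} (A : Matrix (Fin (k + 1)) (Fin (k + 1)) R) (c : R)
    (h0 : A 0 0 = c) (h : ∀ l : Fin k, A 0 l.succ = 0) (n : ℕ) :
    symTrace A (n + 1) = c * symTrace A n + symTrace (A.submatrix Fin.succ Fin.succ) (n + 1) := by
  classical
  have hrow : rowForm A 0 = MvPolynomial.C c * MvPolynomial.X 0 := by
    simp [rowForm, Fin.sum_univ_succ, h0, h]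
  -- Monomials divisible by `X 0` lose one factor `c * X 0`; for the others one may set `X 0 = 0`,
  -- which leaves the smaller block.
  rw [symTrace, ← Finset.sum_filter_add_sum_filter_not _ (fun b => b 0 ≠ 0)]
  congr 1
  · rw [symTrace, Finset.mul_sum]
    symm
    refine Finset.sum_bij' (fun b _ => b + Finsupp.single 0 1) (fun b _ => b - Finsupp.single 0 1)
      ?_ ?_ ?_ ?_ ?_
    · intro b hb
      rw [mem_finsuppAntidiag_univ] at hb
      simp [mem_finsuppAntidiag_univ, Finset.sum_add_distrib, hb, -Finset.mem_finsuppAntidiag]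
    · intro b hb
      rw [Finset.mem_filter, mem_finsuppAntidiag_univ] at hb
      rw [mem_finsuppAntidiag_univ]
      obtain ⟨hb, hb0⟩ := hb
      rw [Fin.sum_univ_succ] at hb ⊢
      simp at hb ⊢
      omega
    · intro b hb
      simp
    · intro b hb
      rw [Finset.mem_filter] at hb
      refine tsub_add_cancel_of_le ?_
      simpa using Nat.one_le_iff_ne_zero.2 hb.2
    · intro b hb
      have : ∏ j, rowForm A j ^ (b + Finsupp.single 0 1 : Fin (k + 1) →₀ ℕ) j =
          MvPolynomial.C c * ((∏ j, rowForm A j ^ b j) * MvPolynomial.X 0) := by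
        simp only [Finsupp.add_apply, pow_add, Finset.prod_mul_distrib]
        rw [Finset.prod_eq_single_of_mem (f := fun j => rowForm A j ^ (Finsupp.single (0 : Fin (k + 1)) 1 : Fin (k + 1) →₀ ℕ) j) 0
          (Finset.mem_univ _) (by intro j _ hj; simp [hj.symm])]
        simp [hrow]; ring
      rw [this, MvPolynomial.coeff_C_mul, MvPolynomial.coeff_mul_X]
  · rw [symTrace]
    symm
    refine Finset.sum_bij' (fun b _ => Finsupp.cons 0 b) (fun b _ => Finsupp.tail b)
      ?_ ?_ ?_ ?_ ?_
    · intro b hb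
      rw [mem_finsuppAntidiag_univ] at hb
      rw [Finset.mem_filter, mem_finsuppAntidiag_univ]
      simp [Fin.sum_univ_succ, hb]
    · intro b hb
      rw [Finset.mem_filter, mem_finsuppAntidiag_univ, Fin.sum_univ_succ] at hb
      rw [mem_finsuppAntidiag_univ]
      simp only [Finsupp.tail_apply]
      omega
    · intro b hb
      simp
    · intro b hb
      rw [Finset.mem_filter] at hb
      have := Finsupp.cons_tail b
      rw [not_not.1 hb.2] at this
      exact this
    · intro b hb
      rw [← MvPolynomial.finSuccEquiv_coeff_coeff, Fin.prod_univ_succ]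
      simp only [Finsupp.cons_zero, pow_zero, one_mul, Finsupp.cons_succ]
      rw [← Polynomial.constantCoeff_apply, map_prod, map_prod]
      congr 1
      refine Finset.prod_congr rfl fun j _ => ?_
      simp only [map_pow]
      congr 1
      simp [rowForm, Fin.sum_univ_succ, MvPolynomial.finSuccEquiv_apply]

theorem charpolyRev_of_row_zero {k : ℕ} (A : Matrix (Fin (k + 1)) (Fin (k + 1)) R) (c : R)
    (h0 : A 0 0 = c) (h : ∀ l : Fin k, A 0 l.succ = 0) :
    A.charpolyRev =
      (1 - Polynomial.C c * Polynomial.X) * (A.submatrix Fin.succ Fin.succ).charpolyRev := by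
  rw [Matrix.charpolyRev, Matrix.det_succ_row_zero, Fin.sum_univ_succ]
  simp only [Matrix.sub_apply, Matrix.smul_apply, Matrix.map_apply, h, h0]
  rw [Finset.sum_eq_zero]
  · simp only [Matrix.charpolyRev, Fin.succAbove_zero]
    simp only [Fin.val_zero, pow_zero, one_mul, Matrix.one_apply_eq, smul_eq_mul, add_zero]
    rw [mul_comm Polynomial.X]
    congr 2
    ext1 i j
    simp [Matrix.one_apply]
  · intro l _
    simp [(Fin.succ_ne_zero l).symm]

theorem charpolyRev_conj {σ : Type*} [Fintype σ] [DecidableEq σ] (A P Q : Matrix σ σ R)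
    (h : Q * P = 1) : (P * A * Q).charpolyRev = A.charpolyRev := by
  have h' : P * Q = 1 := mul_eq_one_comm.1 h
  have e : (1 : Matrix σ σ (Polynomial R)) - (Polynomial.X : Polynomial R) •
      (P * A * Q).map Polynomial.C = P.map Polynomial.C *
        (1 - (Polynomial.X : Polynomial R) • A.map Polynomial.C) * Q.map Polynomial.C := by
    rw [mul_sub, sub_mul, mul_one, ← Matrix.map_mul, h']
    simp [Matrix.map_mul]
  rw [Matrix.charpolyRev, e, Matrix.det_mul, Matrix.det_mul, mul_right_comm, ← Matrix.det_mul,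
    ← Matrix.map_mul, h', Matrix.charpolyRev]
  simp

end Triangular

/-- A left eigenvector `v` becomes the first row of `P`. With `v i ≠ 0`, the identity with row `i`
replaced by `v` is invertible, and swapping rows `0` and `i` puts `v` on top. -/
theorem exists_conj_row_zero {K : Type*} [Field K] [IsAlgClosed K] {k : ℕ}
    (A : Matrix (Fin (k + 1)) (Fin (k + 1)) K) :
    ∃ P Q : Matrix (Fin (k + 1)) (Fin (k + 1)) K, Q * P = 1 ∧
      ∀ l : Fin k, (P * A * Q) 0 l.succ = 0 := by
  obtain ⟨c, hc⟩ := Module.End.exists_eigenvalue (Matrix.toLin' A.transpose)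
  obtain ⟨v, hv⟩ := hc.exists_hasEigenvector
  have hvA : Matrix.vecMul v A = c • v := by
    simpa [Matrix.mulVec_transpose] using hv.apply_eq_smul
  obtain ⟨i, hi⟩ := Function.ne_iff.1 hv.2
  let B : Matrix (Fin (k + 1)) (Fin (k + 1)) K := (1 : Matrix _ _ K).updateRow i v
  let P := B.submatrix (Equiv.swap 0 i) id
  have hB : B.det = v i := by
    have := Matrix.cramer_transpose_apply (1 : Matrix _ _ K) v i
    rw [Matrix.transpose_one, Matrix.cramer_one] at this
    exact this.symm
  have hP : IsUnit P.det := by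
    rw [Matrix.det_permute, hB]
    refine IsUnit.mul ?_ (isUnit_iff_ne_zero.2 hi)
    exact ((Equiv.Perm.sign (Equiv.swap 0 i)).isUnit.map (Int.castRingHom K))
  refine ⟨P, P⁻¹, Matrix.nonsing_inv_mul _ hP, fun l => ?_⟩
  have hrow : P 0 = v := by
    ext j; simp [P, B]
  have : (P * A * P⁻¹) 0 = c • (1 : Matrix (Fin (k + 1)) (Fin (k + 1)) K) 0 := by
    rw [Matrix.mul_assoc, Matrix.mul_apply_eq_vecMul, hrow, ← Matrix.vecMul_vecMul, hvA,
      Matrix.smul_vecMul, ← hrow, ← Matrix.mul_apply_eq_vecMul, Matrix.mul_nonsing_inv _ hP]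
  rw [this]
  simp [(Fin.succ_ne_zero l).symm]

/-- Both factors are conjugation invariant. Once the first row is `(c, 0, …, 0)`, multiplying the
series by `1 - cX` turns it into the series of the remaining block, and induction on the size
applies. -/
theorem charpolyRev_mul_symTrace_of_isAlgClosed {K : Type*} [Field K] [IsAlgClosed K] :
    ∀ {k : ℕ} (A : Matrix (Fin k) (Fin k) K),
      (A.charpolyRev : PowerSeries K) * PowerSeries.mk (symTrace A) = 1
  | 0, A => by
    have : A.charpolyRev = 1 := by simp [Matrix.charpolyRev]
    rw [this]
    ext n
    rcases n with _ | n
    · simp [symTrace_zero]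
    · have : Finset.finsuppAntidiag (Finset.univ : Finset (Fin 0)) (n + 1) = ∅ := by
        ext b
        rw [mem_finsuppAntidiag_univ]
        simp
      simp [symTrace, PowerSeries.coeff_one]
  | k + 1, A => by
    obtain ⟨P, Q, hQP, h⟩ := exists_conj_row_zero A
    have htr : symTrace A = symTrace (P * A * Q) := by
      ext n
      rw [symTrace_mul_comm, ← Matrix.mul_assoc, hQP, Matrix.one_mul]
    rw [← charpolyRev_conj A P Q hQP, htr]
    set B := P * A * Q
    rw [charpolyRev_of_row_zero B _ rfl h, Polynomial.coe_mul, mul_right_comm,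
      mul_comm _ (((B.submatrix _ _).charpolyRev : PowerSeries K)),
      ← charpolyRev_mul_symTrace_of_isAlgClosed (B.submatrix Fin.succ Fin.succ)]
    congr 1
    ext n
    rw [Polynomial.coe_sub, Polynomial.coe_mul, Polynomial.coe_C, Polynomial.coe_X,
      Polynomial.coe_one, sub_mul, one_mul, map_sub, mul_assoc, PowerSeries.coeff_C_mul]
    rcases n with _ | n
    · simp [symTrace_zero]
    · rw [PowerSeries.coeff_succ_X_mul]
      simp [symTrace_succ_of_row_zero B _ rfl h]

/-- MacMahon's master theorem, specialised to one variable, for integer matrices. -/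
theorem charpolyRev_mul_symTrace {k : ℕ} (A : Matrix (Fin k) (Fin k) ℤ) :
    (A.charpolyRev : PowerSeries ℤ) * PowerSeries.mk (symTrace A) = 1 := by
  have hinj : Function.Injective (PowerSeries.map (Int.castRingHom ℂ)) :=
    PowerSeries.map_injective _ Int.cast_injective
  apply hinj
  rw [map_one, map_mul, ← charpolyRev_mul_symTrace_of_isAlgClosed (A.map (Int.castRingHom ℂ))]
  congr 1
  · rw [← Polynomial.polynomial_map_coe]
    congr 1
    rw [Matrix.charpolyRev, Matrix.charpolyRev, ← Polynomial.coe_mapRingHom, RingHom.map_det]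
    congr 1
    ext1 i j
    simp [Matrix.one_apply, apply_ite]
  · ext n
    rw [PowerSeries.coeff_map, PowerSeries.coeff_mk, PowerSeries.coeff_mk, map_symTrace]

/-! ### Typed segmentations encoded as words. -/

/-- `IsTypedSegmentation τ (π, seg)`: the map `seg` cuts the positions into consecutive segments,
`π` is increasing on each segment, and the values of `π` on the segment `j` are larger than
their positions if `τ j`, and smaller otherwise. -/
structure IsTypedSegmentation {n : ℕ} {ι : Type*} [LinearOrder ι] (τ : ι → Bool)
    (p : Equiv.Perm (Fin n) × (Fin n → ι)) : Prop where
  mono : Monotone p.2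
  inc : ∀ i j, i < j → p.2 i = p.2 j → p.1 i < p.1 j
  up : ∀ i, τ (p.2 i) = true → i < p.1 i
  down : ∀ i, τ (p.2 i) = false → p.1 i < i

/-- The letter `l` may be attached to the value `v`, which as a position lies in the segment
`seg v`. -/
def LetterOK {n : ℕ} {ι : Type*} [LinearOrder ι] (τ : ι → Bool) (seg : Fin n → ι) (v : Fin n)
    (l : ι) : Prop :=
  (τ l = true → l ≤ seg v ∧ (l = seg v → ∃ v' < v, seg v' = seg v)) ∧
    (τ l = false → seg v ≤ l ∧ (l = seg v → ∃ v' > v, seg v' = seg v))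

section Words

variable {n : ℕ} {ι : Type*} [LinearOrder ι]

/-- `π` lists the values by segment and increasingly inside each segment, which is the stable sort
of the word. -/
theorem IsTypedSegmentation.eq_sort {τ : ι → Bool} {p : Equiv.Perm (Fin n) × (Fin n → ι)}
    (h : IsTypedSegmentation τ p) : p.1 = Tuple.sort (p.2 ∘ p.1.symm) := by
  rw [Tuple.eq_sort_iff]
  have e : (p.2 ∘ p.1.symm) ∘ p.1 = p.2 := by ext; simp
  refine ⟨by rw [e]; exact h.mono, fun i j hij hw => h.inc i j hij ?_⟩
  simpa using hw

theorem IsTypedSegmentation.letterOK {τ : ι → Bool} {p : Equiv.Perm (Fin n) × (Fin n → ι)}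
    (h : IsTypedSegmentation τ p) (v : Fin n) : LetterOK τ p.2 v (p.2 (p.1.symm v)) := by
  obtain ⟨i, rfl⟩ := p.1.surjective v
  rw [Equiv.symm_apply_apply]
  exact ⟨fun ht => ⟨h.mono (h.up i ht).le, fun e => ⟨i, h.up i ht, e⟩⟩,
    fun ht => ⟨h.mono (h.down i ht).le, fun e => ⟨i, h.down i ht, e⟩⟩⟩

/-- Suppose `π i ≤ i` in an upward segment. The letter condition forces `π i` into the segment of
`i`, with an earlier position there, so `i - 1` is in it too. By induction `i - 1 < π (i - 1) < π
i`, a contradiction. Downward segments are the mirror image, with induction from the right end. -/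
theorem isTypedSegmentation_sort {τ : ι → Bool} {w : Fin n → ι}
    (h : ∀ v, LetterOK τ (w ∘ Tuple.sort w) v (w v)) :
    IsTypedSegmentation τ (Tuple.sort w, w ∘ Tuple.sort w) := by
  have hmono : Monotone (w ∘ Tuple.sort w) := Tuple.monotone_sort w
  have hinc : ∀ i j, i < j → w (Tuple.sort w i) = w (Tuple.sort w j) →
      Tuple.sort w i < Tuple.sort w j := (Tuple.eq_sort_iff.1 rfl).2
  set π := Tuple.sort w
  refine ⟨hmono, hinc, fun i => ?_, fun i => ?_⟩
  · induction hi : (i : ℕ) using Nat.strong_induction_on generalizing i with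
    | _ m ih =>
    intro ht
    by_contra hlt
    rw [not_lt] at hlt
    obtain ⟨h1, h2⟩ := (h (π i)).1 ht
    obtain ⟨v', hv', e⟩ := h2 (le_antisymm h1 (hmono hlt))
    have hseg : (w ∘ π) v' = (w ∘ π) i := e.trans (le_antisymm h1 (hmono hlt)).symm
    have hv'i : v' < i := hv'.trans_le hlt
    have hpos : (i : ℕ) - 1 < n := by omega
    let i' : Fin n := ⟨i - 1, hpos⟩
    have hi' : i' < i := by simp only [i', Fin.lt_def] at *; omega
    have hvi' : v' ≤ i' := by simp only [i', Fin.lt_def, Fin.le_def] at *; omega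
    have hsi : (w ∘ π) i' = (w ∘ π) i :=
      le_antisymm (hmono hi'.le) (hseg ▸ hmono hvi')
    have h3 := ih i' (by simp only [Fin.lt_def] at hi'; omega) i' rfl (by
      simp only at ht ⊢; rw [hsi]; exact ht)
    have h4 := hinc i' i hi' hsi
    simp only [i', Fin.lt_def, Fin.le_def] at *
    omega
  · induction hi : n - (i : ℕ) using Nat.strong_induction_on generalizing i with
    | _ m ih =>
    intro ht
    by_contra hlt
    rw [not_lt] at hlt
    obtain ⟨h1, h2⟩ := (h (π i)).2 ht
    obtain ⟨v', hv', e⟩ := h2 (le_antisymm (hmono hlt) h1)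
    have hseg : (w ∘ π) v' = (w ∘ π) i := e.trans (le_antisymm (hmono hlt) h1).symm
    have hv'i : i < v' := hlt.trans_lt hv'
    have hpos : (i : ℕ) + 1 < n := by have := v'.2; simp only [Fin.lt_def] at hv'i; omega
    let i' : Fin n := ⟨i + 1, hpos⟩
    have hi' : i < i' := by simp only [i', Fin.lt_def] at *; omega
    have hvi' : i' ≤ v' := by simp only [i', Fin.lt_def, Fin.le_def] at *; omega
    have hsi : (w ∘ π) i = (w ∘ π) i' :=
      le_antisymm (hmono hi'.le) (hseg ▸ hmono hvi')
    have h3 := ih (n - i') (by simp only [i', Fin.lt_def] at hi' ⊢; omega) i' rfl (by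
      simp only at ht ⊢; rw [← hsi]; exact ht)
    have h4 := hinc i i' hi' hsi
    simp only [i', Fin.lt_def, Fin.le_def] at *
    omega

open Classical in
/-- The number of typed segmentations of permutations of `Fin n`. -/
noncomputable def segCount {ι : Type*} [LinearOrder ι] [Fintype ι] (τ : ι → Bool) (n : ℕ) : ℕ :=
  (Finset.univ.filter fun p : Equiv.Perm (Fin n) × (Fin n → ι) => IsTypedSegmentation τ p).card

open Classical in
theorem segCount_eq_card_words [Fintype ι] (τ : ι → Bool) (n : ℕ) :
    segCount τ n = (Finset.univ.filter fun w : Fin n → ι =>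
      ∀ v, LetterOK τ (w ∘ Tuple.sort w) v (w v)).card := by
  refine Finset.card_bij' (fun p _ => p.2 ∘ p.1.symm) (fun w _ => (Tuple.sort w, w ∘ Tuple.sort w))
    ?_ ?_ ?_ ?_
  · intro p hp
    rw [Finset.mem_filter] at hp
    have e : (p.2 ∘ p.1.symm) ∘ Tuple.sort (p.2 ∘ p.1.symm) = p.2 := by
      rw [← hp.2.eq_sort]; ext; simp
    simp only [Finset.mem_filter, Finset.mem_univ, true_and, e]
    exact hp.2.letterOK
  · intro w hw
    rw [Finset.mem_filter] at hw
    simpa using isTypedSegmentation_sort hw.2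
  · intro p hp
    rw [Finset.mem_filter] at hp
    rw [← hp.2.eq_sort]
    ext <;> simp
  · intro w hw
    ext; simp

end Words

/-! ### Words with given letter multiplicities. -/

section Content

variable {n : ℕ} {ι : Type*}

/-- The multiplicities of the letters of a word. -/
noncomputable def content (w : Fin n → ι) : ι →₀ ℕ := ∑ v, Finsupp.single (w v) 1

theorem toMultiset_content (w : Fin n → ι) :
    Finsupp.toMultiset (content w) = (List.ofFn w : Multiset ι) := by
  rw [content, map_sum, ← Fin.univ_val_map, ← Finset.sum_multiset_singleton,
    ← Multiset.coe_mapAddMonoidHom, map_sum]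
  simp

theorem exists_content_eq [Fintype ι] {a : ι →₀ ℕ} (ha : ∑ j, a j = n) :
    ∃ w : Fin n → ι, content w = a := by
  classical
  have hl : (Finsupp.toMultiset a).toList.length = n := by
    rw [Multiset.length_toList, Finsupp.card_toMultiset, Finsupp.sum_fintype _ _ (by simp), ← ha]
    rfl
  subst hl
  refine ⟨(Finsupp.toMultiset a).toList.get, Multiset.toFinsupp.symm.injective ?_⟩
  change Finsupp.toMultiset (content _) = Finsupp.toMultiset a
  rw [toMultiset_content, List.ofFn_get, Multiset.coe_toList]

theorem content_comp_perm (w : Fin n → ι) (σ : Equiv.Perm (Fin n)) :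
    content (w ∘ σ) = content w :=
  Equiv.sum_comp σ fun v => Finsupp.single (w v) 1

/-- Hence the sets of admissible letters are constant on the words of one content, and these can be
counted by a single product. -/
theorem sort_eq_of_content_eq [LinearOrder ι] {w w' : Fin n → ι} (h : content w = content w') :
    w ∘ Tuple.sort w = w' ∘ Tuple.sort w' := by
  have h' : (List.ofFn (w ∘ Tuple.sort w)).Perm (List.ofFn (w' ∘ Tuple.sort w')) := by
    rw [← Multiset.coe_eq_coe, ← toMultiset_content, ← toMultiset_content, content_comp_perm,
      content_comp_perm, h]
  exact List.ofFn_injective (h'.eq_of_pairwise'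
    (Tuple.monotone_sort w).sortedLE_ofFn.pairwise (Tuple.monotone_sort w').sortedLE_ofFn.pairwise)

theorem content_apply [DecidableEq ι] (w : Fin n → ι) (j : ι) :
    content w j = (Finset.univ.filter fun v => w v = j).card := by
  simp only [content, Finsupp.finsetSum_apply, Finsupp.single_apply, Finset.card_filter]

theorem sum_content [Fintype ι] (w : Fin n → ι) : ∑ j, content w j = n := by
  classical
  simp only [content_apply]
  rw [← Finset.card_eq_sum_card_fiberwise (s := Finset.univ) (f := w) (t := Finset.univ)
    (fun _ _ => Finset.mem_coe.2 (Finset.mem_univ _))]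
  simp

theorem card_words_with_content [Fintype ι] [DecidableEq ι] (t : Fin n → Finset ι) (a : ι →₀ ℕ) :
    ((Finset.univ.filter fun w : Fin n → ι => content w = a ∧ ∀ v, w v ∈ t v).card : ℤ) =
      MvPolynomial.coeff a (∏ v, ∑ l ∈ t v, (MvPolynomial.X l : MvPolynomial ι ℤ)) := by
  have h : ∀ w : Fin n → ι, ∏ v, (MvPolynomial.X (w v) : MvPolynomial ι ℤ) =
      MvPolynomial.monomial (content w) 1 := fun w => by
    simp only [MvPolynomial.X]
    rw [content, MvPolynomial.monomial_sum_one]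
  rw [Finset.prod_univ_sum, MvPolynomial.coeff_sum]
  simp only [h, MvPolynomial.coeff_monomial]
  rw [Finset.sum_boole]
  congr 2
  ext w
  simp [Fintype.mem_piFinset, and_comm]

end Content

/-! ### Admissible letters and the transfer matrix. -/

section Transfer

variable {n : ℕ} {ι : Type*} [LinearOrder ι] [Fintype ι]

/-- The `0`-`1` matrix of the letters that are possible in each segment. -/
def letterMatrix (τ : ι → Bool) : Matrix ι ι ℤ := fun j l =>
  if (if τ l = true then l ≤ j else j ≤ l) then 1 else 0

open Classical in
/-- The set of the letters which may be attached to the value `v`. -/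
noncomputable def letterSet (τ : ι → Bool) (seg : Fin n → ι) (v : Fin n) : Finset ι :=
  Finset.univ.filter (LetterOK τ seg v)

theorem rowForm_letterMatrix (τ : ι → Bool) (j : ι) :
    rowForm (letterMatrix τ) j =
      ∑ l ∈ Finset.univ.filter (fun l => if τ l = true then l ≤ j else j ≤ l),
        (MvPolynomial.X l : MvPolynomial ι ℤ) := by
  rw [rowForm, Finset.sum_filter]
  refine Finset.sum_congr rfl fun l _ => ?_
  rw [letterMatrix]
  split_ifs <;> simp

theorem sum_letterSet_of_exists (τ : ι → Bool) (seg : Fin n → ι) (v : Fin n)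
    (h : if τ (seg v) = true then ∃ v' < v, seg v' = seg v else ∃ v' > v, seg v' = seg v) :
    ∑ l ∈ letterSet τ seg v, (MvPolynomial.X l : MvPolynomial ι ℤ) =
      rowForm (letterMatrix τ) (seg v) := by
  rw [rowForm_letterMatrix]
  congr 1
  ext l
  simp only [letterSet, LetterOK, Finset.mem_filter, Finset.mem_univ, true_and]
  rcases eq_or_ne l (seg v) with rfl | hl
  · cases ht : τ (seg v) <;> simp_all
  · cases ht : τ l <;> simp [hl]

theorem sum_letterSet_of_not_exists (τ : ι → Bool) (seg : Fin n → ι) (v : Fin n)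
    (h : ¬ if τ (seg v) = true then ∃ v' < v, seg v' = seg v else ∃ v' > v, seg v' = seg v) :
    ∑ l ∈ letterSet τ seg v, (MvPolynomial.X l : MvPolynomial ι ℤ) =
      rowForm (letterMatrix τ) (seg v) - MvPolynomial.X (seg v) := by
  rw [rowForm_letterMatrix, ← Finset.sum_erase_eq_sub (by simp)]
  congr 1
  ext l
  simp only [letterSet, LetterOK, Finset.mem_filter, Finset.mem_univ, true_and, Finset.mem_erase]
  rcases eq_or_ne l (seg v) with rfl | hl
  · cases ht : τ (seg v) <;> simp_all
  · cases ht : τ l <;> simp [hl]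

/-- Every value in segment `j` admits the letters of row `j`, except one extreme value, which may
not carry `j` itself. That one factor gives the correction term. -/
theorem prod_sum_letterSet_fiber (τ : ι → Bool) (seg : Fin n → ι) (j : ι) :
    ∏ v ∈ Finset.univ.filter (fun v => seg v = j),
        ∑ l ∈ letterSet τ seg v, (MvPolynomial.X l : MvPolynomial ι ℤ) =
      rowForm (letterMatrix τ) j ^ content seg j -
        if content seg j = 0 then 0
        else MvPolynomial.X j * rowForm (letterMatrix τ) j ^ (content seg j - 1) := by
  rw [content_apply]
  set F := Finset.univ.filter (fun v => seg v = j) with hF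
  rcases F.eq_empty_or_nonempty with h0 | hne
  · simp [h0]
  -- The exceptional value is the first of an upward segment and the last of a downward one.
  obtain ⟨v₀, hv₀, hext⟩ : ∃ v₀ ∈ F, ∀ v ∈ F, v ≠ v₀ →
      if τ j = true then v₀ < v else v < v₀ := by
    cases ht : τ j
    · refine ⟨F.max' hne, F.max'_mem hne, fun v hv hne' => ?_⟩
      simpa using lt_of_le_of_ne (F.le_max' v hv) hne'
    · refine ⟨F.min' hne, F.min'_mem hne, fun v hv hne' => ?_⟩
      simpa using lt_of_le_of_ne (F.min'_le v hv) hne'.symm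
  have hmem : ∀ v, v ∈ F ↔ seg v = j := fun v => by simp [hF]
  have hs₀ := (hmem v₀).1 hv₀
  have e₀ := sum_letterSet_of_not_exists τ seg v₀ (by
    rw [hs₀]
    cases ht : τ j
    · simp only [Bool.false_eq_true, if_false]
      rintro ⟨v, hv, e⟩
      have := hext v ((hmem v).2 e) (ne_of_gt hv)
      simp only [ht, Bool.false_eq_true, if_false] at this
      exact lt_asymm hv this
    · simp only [if_true]
      rintro ⟨v, hv, e⟩
      have := hext v ((hmem v).2 e) (ne_of_lt hv)
      simp only [ht, if_true] at this
      exact lt_asymm hv this)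
  rw [← Finset.mul_prod_erase F _ hv₀, e₀, hs₀,
    Finset.prod_congr rfl (g := fun _ => rowForm (letterMatrix τ) j), Finset.prod_const,
    Finset.card_erase_of_mem hv₀, if_neg (Finset.card_ne_zero_of_mem hv₀)]
  · obtain ⟨m, hm⟩ := Nat.exists_eq_succ_of_ne_zero (Finset.card_ne_zero_of_mem hv₀)
    rw [hm]
    simp only [Nat.succ_eq_add_one, Nat.add_sub_cancel]
    ring
  · intro v hv
    rw [Finset.mem_erase] at hv
    have hs := (hmem v).1 hv.2
    have := hext v hv.2 hv.1
    rw [sum_letterSet_of_exists τ seg v, hs]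
    rw [hs]
    cases ht : τ j
    · simp only [ht, Bool.false_eq_true, if_false] at this ⊢
      exact ⟨v₀, this, hs₀⟩
    · simp only [ht, if_true] at this ⊢
      exact ⟨v₀, this, hs₀⟩

theorem segCount_eq_sum_coeff (τ : ι → Bool) (n : ℕ) :
    (segCount τ n : ℤ) = ∑ a ∈ Finset.finsuppAntidiag (Finset.univ : Finset ι) n,
      MvPolynomial.coeff a (∏ j, (rowForm (letterMatrix τ) j ^ a j -
        if a j = 0 then 0 else MvPolynomial.X j * rowForm (letterMatrix τ) j ^ (a j - 1))) := by
  classical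
  rw [segCount_eq_card_words, Finset.card_eq_sum_card_fiberwise (f := content)
    (t := Finset.finsuppAntidiag (Finset.univ : Finset ι) n)
    (fun w _ => Finset.mem_coe.2 (mem_finsuppAntidiag_univ.2 (sum_content w))), Nat.cast_sum]
  refine Finset.sum_congr rfl fun a ha => ?_
  -- Any word of content `a` serves to name the common sorted word.
  obtain ⟨w₀, hw₀⟩ := exists_content_eq (mem_finsuppAntidiag_univ.1 ha)
  have hseg : content (w₀ ∘ Tuple.sort w₀) = a := by rw [content_comp_perm, hw₀]
  have : ∀ j, (rowForm (letterMatrix τ) j ^ a j -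
        if a j = 0 then 0 else MvPolynomial.X j * rowForm (letterMatrix τ) j ^ (a j - 1)) =
      ∏ v ∈ Finset.univ.filter (fun v => (w₀ ∘ Tuple.sort w₀) v = j),
        ∑ l ∈ letterSet τ (w₀ ∘ Tuple.sort w₀) v, (MvPolynomial.X l : MvPolynomial ι ℤ) :=
    fun j => by rw [prod_sum_letterSet_fiber, hseg]
  simp only [this]
  rw [Finset.prod_fiberwise, ← card_words_with_content]
  congr 2
  ext w
  simp only [Finset.mem_filter, Finset.mem_univ, true_and, letterSet]
  constructor
  · rintro ⟨h1, h2⟩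
    refine ⟨h2, fun v => ?_⟩
    rw [← sort_eq_of_content_eq (h2.trans hw₀.symm)]
    exact h1 v
  · rintro ⟨h2, h1⟩
    refine ⟨fun v => ?_, h2⟩
    rw [sort_eq_of_content_eq (h2.trans hw₀.symm)]
    exact h1 v

end Transfer

/-! ### Generating function of typed segmentations. -/

section GeneratingFunction

variable {ι : Type*} [Fintype ι] [DecidableEq ι]

/-- With `e` the indicator of `S`, only `a = b + e` contributes. Cancelling the monomial of `e`
leaves the diagonal coefficient at `b`, of degree smaller by `S.card`. -/
theorem sum_coeff_prod_shift (A : Matrix ι ι ℤ) (S : Finset ι) (n : ℕ) :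
    ∑ a ∈ Finset.finsuppAntidiag (Finset.univ : Finset ι) n,
      MvPolynomial.coeff a ((∏ j ∈ Finset.univ \ S, rowForm A j ^ a j) *
        ∏ j ∈ S, if a j = 0 then 0 else MvPolynomial.X j * rowForm A j ^ (a j - 1)) =
      PowerSeries.coeff n ((PowerSeries.X : PowerSeries ℤ) ^ S.card *
        PowerSeries.mk (symTrace A)) := by
  let e : ι →₀ ℕ := ∑ j ∈ S, Finsupp.single j 1
  have he : ∀ j, e j = if j ∈ S then 1 else 0 := fun j => by
    simp [e, Finsupp.finsetSum_apply, Finsupp.single_apply]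
  have hcard : ∑ j, e j = S.card := by simp [he]
  have hterm : ∀ b : ι →₀ ℕ,
      MvPolynomial.coeff (b + e) ((∏ j ∈ Finset.univ \ S, rowForm A j ^ (b + e) j) *
        ∏ j ∈ S, if (b + e) j = 0 then 0
          else MvPolynomial.X j * rowForm A j ^ ((b + e) j - 1)) =
        MvPolynomial.coeff b (∏ j, rowForm A j ^ b j) := by
    intro b
    have h1 : ∏ j ∈ Finset.univ \ S, rowForm A j ^ (b + e) j =
        ∏ j ∈ Finset.univ \ S, rowForm A j ^ b j :=
      Finset.prod_congr rfl fun j hj => by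
        rw [Finset.mem_sdiff] at hj
        rw [Finsupp.add_apply, he, if_neg hj.2, add_zero]
    have h2 : (∏ j ∈ S, if (b + e) j = 0 then 0
          else MvPolynomial.X j * rowForm A j ^ ((b + e) j - 1)) =
        MvPolynomial.monomial e 1 * ∏ j ∈ S, rowForm A j ^ b j := by
      have : MvPolynomial.monomial e (1 : ℤ) = ∏ j ∈ S, MvPolynomial.X j := by
        simp only [MvPolynomial.X, e]
        rw [MvPolynomial.monomial_sum_one]
      rw [this, ← Finset.prod_mul_distrib]
      refine Finset.prod_congr rfl fun j hj => ?_
      rw [Finsupp.add_apply, he, if_pos hj, if_neg (Nat.succ_ne_zero _), Nat.add_sub_cancel]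
    rw [h1, h2, mul_left_comm, Finset.prod_sdiff (Finset.subset_univ S), add_comm b e,
      MvPolynomial.coeff_monomial_mul, one_mul]
  have hzero : ∀ a : ι →₀ ℕ, ¬ e ≤ a →
      MvPolynomial.coeff a ((∏ j ∈ Finset.univ \ S, rowForm A j ^ a j) *
        ∏ j ∈ S, if a j = 0 then 0 else MvPolynomial.X j * rowForm A j ^ (a j - 1)) = 0 := by
    intro a ha
    obtain ⟨j, hj⟩ : ∃ j, ¬ e j ≤ a j := by
      by_contra! h
      exact ha h
    rw [he] at hj
    split_ifs at hj with hS
    · rw [Finset.prod_eq_zero hS (by rw [if_pos (by omega)]), mul_zero, MvPolynomial.coeff_zero]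
    · simp at hj
  rw [PowerSeries.coeff_X_pow_mul', PowerSeries.coeff_mk]
  classical
  rw [← Finset.sum_filter_of_ne (p := fun a => e ≤ a) fun a _ h => by
    by_contra hle; exact h (hzero a hle)]
  split_ifs with hn
  · rw [symTrace]
    symm
    refine Finset.sum_bij' (fun b _ => b + e) (fun a _ => a - e) ?_ ?_ ?_ ?_ ?_
    · intro b hb
      rw [mem_finsuppAntidiag_univ] at hb
      rw [Finset.mem_filter, mem_finsuppAntidiag_univ]
      refine ⟨?_, le_add_self⟩
      simp only [Finsupp.add_apply, Finset.sum_add_distrib, hb, hcard]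
      omega
    · intro a ha
      rw [Finset.mem_filter, mem_finsuppAntidiag_univ] at ha
      rw [mem_finsuppAntidiag_univ]
      obtain ⟨c, rfl⟩ := exists_add_of_le ha.2
      have := ha.1
      simp only [Finsupp.add_apply, Finset.sum_add_distrib, hcard] at this
      rw [add_tsub_cancel_left]
      omega
    · intro b _
      simp
    · intro a ha
      rw [Finset.mem_filter] at ha
      exact tsub_add_cancel_of_le ha.2
    · intro b _
      exact (hterm b).symm
  · refine Finset.sum_eq_zero fun a ha => ?_
    rw [Finset.mem_filter, mem_finsuppAntidiag_univ] at ha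
    exfalso
    apply hn
    rw [← hcard, ← ha.1]
    exact Finset.sum_le_sum fun j _ => ha.2 j

end GeneratingFunction

/-- `S` records the segments from which the correction term is taken; summed over `S`, the
prefactors give a power of `1 - X`. -/
theorem mk_segCount_eq {ι : Type*} [LinearOrder ι] [Fintype ι] (τ : ι → Bool) :
    (PowerSeries.mk fun n => (segCount τ n : ℤ)) =
      ∑ S ∈ (Finset.univ : Finset ι).powerset, (-1) ^ S.card *
        ((PowerSeries.X : PowerSeries ℤ) ^ S.card *
          PowerSeries.mk (symTrace (letterMatrix τ))) := by
  ext n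
  rw [PowerSeries.coeff_mk, segCount_eq_sum_coeff, map_sum]
  simp only [Finset.prod_sub]
  have : ∀ S : Finset ι, PowerSeries.coeff n ((-1) ^ S.card *
        ((PowerSeries.X : PowerSeries ℤ) ^ S.card *
          PowerSeries.mk (symTrace (letterMatrix τ)))) = (-1) ^ S.card *
      PowerSeries.coeff n ((PowerSeries.X : PowerSeries ℤ) ^ S.card *
          PowerSeries.mk (symTrace (letterMatrix τ))) := fun S => by
    have : ((-1 : PowerSeries ℤ)) ^ S.card = PowerSeries.C ((-1) ^ S.card) := by simp
    rw [this, PowerSeries.coeff_C_mul]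
  simp only [this, ← sum_coeff_prod_shift, MvPolynomial.coeff_sum]
  rw [Finset.sum_comm]
  refine Finset.sum_congr rfl fun S _ => ?_
  rw [Finset.mul_sum]
  refine Finset.sum_congr rfl fun a _ => ?_
  have : ((-1 : MvPolynomial ι ℤ)) ^ S.card = MvPolynomial.C ((-1) ^ S.card) := by simp
  rw [this, mul_assoc, MvPolynomial.coeff_C_mul]

theorem charpolyRev_mul_mk_segCount {k : ℕ} (τ : Fin k → Bool) :
    ((letterMatrix τ).charpolyRev : PowerSeries ℤ) *
        (PowerSeries.mk fun n => (segCount τ n : ℤ)) =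
      ((∑ S ∈ (Finset.univ : Finset (Fin k)).powerset,
        (-1) ^ S.card * Polynomial.X ^ S.card : Polynomial ℤ) : PowerSeries ℤ) := by
  have h := charpolyRev_mul_symTrace (letterMatrix τ)
  rw [mk_segCount_eq, Finset.mul_sum, ← Polynomial.coeToPowerSeries.ringHom_apply (φ := ∑ S ∈ _, _),
    map_sum]
  refine Finset.sum_congr rfl fun S _ => ?_
  rw [mul_left_comm, mul_left_comm (Polynomial.toPowerSeries _), h, mul_one]
  simp

theorem charpolyRev_ne_zero {σ R : Type*} [Fintype σ] [DecidableEq σ] [CommRing R] [Nontrivial R]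
    (A : Matrix σ σ R) : A.charpolyRev ≠ 0 := by
  intro h
  have := Matrix.eval_charpolyRev (M := A)
  rw [h] at this
  simp at this

theorem powerSeries_derivative_mul {R : Type*} [CommRing R] (f g : PowerSeries R) :
    PowerSeries.derivative R (f * g) =
      f * PowerSeries.derivative R g + g * PowerSeries.derivative R f :=
  Derivation.leibniz _ _ _

/-! ### Closure properties of rational series. -/

section Rational

theorem IsRationalFraction.add {f g : PowerSeries (Polynomial ℤ)} (hf : IsRationalFraction f)
    (hg : IsRationalFraction g) : IsRationalFraction (f + g) := by
  obtain ⟨P, Q, hQ, h⟩ := hf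
  obtain ⟨P', Q', hQ', h'⟩ := hg
  refine ⟨Q' * P + Q * P', Q * Q', mul_ne_zero hQ hQ', ?_⟩
  push_cast
  rw [← h, ← h']
  ring

theorem isRationalFraction_coe (P : Polynomial (Polynomial ℤ)) :
    IsRationalFraction (P : PowerSeries (Polynomial ℤ)) :=
  ⟨P, 1, one_ne_zero, by simp⟩

theorem IsRationalFraction.coe_mul {f : PowerSeries (Polynomial ℤ)} (hf : IsRationalFraction f)
    (R : Polynomial (Polynomial ℤ)) : IsRationalFraction ((R : PowerSeries (Polynomial ℤ)) * f) := by
  obtain ⟨P, Q, hQ, h⟩ := hf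
  refine ⟨R * P, Q, hQ, ?_⟩
  push_cast
  rw [← h]
  ring

theorem IsRationalFraction.C_mul {f : PowerSeries (Polynomial ℤ)} (hf : IsRationalFraction f)
    (c : Polynomial ℤ) : IsRationalFraction (PowerSeries.C c * f) := by
  simpa using hf.coe_mul (Polynomial.C c)

theorem IsRationalFraction.of_coe_mul {f : PowerSeries (Polynomial ℤ)}
    {R : Polynomial (Polynomial ℤ)} (hR : R ≠ 0)
    (hf : IsRationalFraction ((R : PowerSeries (Polynomial ℤ)) * f)) : IsRationalFraction f := by
  obtain ⟨P, Q, hQ, h⟩ := hf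
  refine ⟨P, Q * R, mul_ne_zero hQ hR, ?_⟩
  push_cast
  rw [← h]
  ring

theorem IsRationalFraction.sub {f g : PowerSeries (Polynomial ℤ)} (hf : IsRationalFraction f)
    (hg : IsRationalFraction g) : IsRationalFraction (f - g) := by
  have := hf.add (hg.C_mul (-1))
  simpa [sub_eq_add_neg] using this

theorem isRationalFraction_sum {κ : Type*} (s : Finset κ) (f : κ → PowerSeries (Polynomial ℤ))
    (h : ∀ i ∈ s, IsRationalFraction (f i)) : IsRationalFraction (∑ i ∈ s, f i) := by
  classical
  induction s using Finset.induction_on with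
  | empty => simpa using isRationalFraction_coe 0
  | insert a s ha ih =>
    rw [Finset.sum_insert ha]
    exact (h a (Finset.mem_insert_self a s)).add
      (ih fun i hi => h i (Finset.mem_insert_of_mem hi))

theorem IsRationalFraction.derivative {f : PowerSeries (Polynomial ℤ)}
    (hf : IsRationalFraction f) :
    IsRationalFraction (PowerSeries.derivative (Polynomial ℤ) f) := by
  obtain ⟨P, Q, hQ, h⟩ := hf
  refine ⟨Q * P.derivative - Q.derivative * P, Q * Q, mul_ne_zero hQ hQ, ?_⟩
  have h' := congrArg (PowerSeries.derivative (Polynomial ℤ)) h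
  have leibniz : PowerSeries.derivative (Polynomial ℤ) ((Q : PowerSeries (Polynomial ℤ)) * f) =
      Q * PowerSeries.derivative (Polynomial ℤ) f +
        f * PowerSeries.derivative (Polynomial ℤ) (Q : PowerSeries (Polynomial ℤ)) :=
    powerSeries_derivative_mul _ _
  rw [leibniz, PowerSeries.derivative_coe, PowerSeries.derivative_coe] at h'
  push_cast
  rw [← h, ← h']
  ring

/-- Multiplication of the coefficients by their index preserves rationality. -/
theorem IsRationalFraction.index_mul {f : ℕ → Polynomial ℤ}
    (hf : IsRationalFraction (PowerSeries.mk f)) :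
    IsRationalFraction (PowerSeries.mk fun n => (n : Polynomial ℤ) * f n) := by
  have h := hf.derivative.coe_mul Polynomial.X
  convert h using 1
  ext1 n
  rw [Polynomial.coe_X]
  rcases n with _ | n
  · simp
  · rw [PowerSeries.coeff_succ_X_mul, PowerSeries.coeff_derivative]
    simp [mul_comm]

/-- Induction through (j+1) C(d, j+1) = (d-j) C(d, j) with d = n - c, where multiplication by n is u
d/du. The vanishing below `c` makes the truncated subtraction harmless. -/
theorem IsRationalFraction.choose_mul {f : ℕ → Polynomial ℤ} {c : ℕ} (h0 : ∀ n < c, f n = 0)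
    (hf : IsRationalFraction (PowerSeries.mk f)) (j : ℕ) :
    IsRationalFraction (PowerSeries.mk fun n => ((n - c).choose j : Polynomial ℤ) * f n) := by
  induction j with
  | zero => simpa using hf
  | succ j ih =>
    refine IsRationalFraction.of_coe_mul (R := ((j + 1 : ℕ) : Polynomial (Polynomial ℤ)))
      (Nat.cast_ne_zero.2 j.succ_ne_zero) ?_
    convert ih.index_mul.sub (ih.C_mul ((c + j : ℕ) : Polynomial ℤ)) using 1
    ext1 n
    have e : ((((j + 1 : ℕ) : Polynomial (Polynomial ℤ))) : PowerSeries (Polynomial ℤ)) =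
        PowerSeries.C (((j + 1 : ℕ) : Polynomial ℤ)) := by
      rw [← Polynomial.coe_C, map_natCast]
    rw [e, PowerSeries.coeff_C_mul, map_sub, PowerSeries.coeff_C_mul, PowerSeries.coeff_mk,
      PowerSeries.coeff_mk, PowerSeries.coeff_mk]
    rcases lt_or_ge n c with hn | hn
    · simp [h0 n hn]
    · obtain ⟨d, rfl⟩ := Nat.exists_eq_add_of_le hn
      rw [Nat.add_sub_cancel_left]
      have key : ((j + 1 : ℕ) : Polynomial ℤ) * (d.choose (j + 1) : Polynomial ℤ) =
          ((d : Polynomial ℤ) - j) * (d.choose j : Polynomial ℤ) := by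
        have h := Nat.choose_succ_right_eq d j
        rcases le_or_gt j d with hj | hj
        · have h' := congrArg (Nat.cast : ℕ → Polynomial ℤ) h
          rw [Nat.cast_mul, Nat.cast_mul, Nat.cast_sub hj] at h'
          linear_combination h'
        · rw [Nat.choose_eq_zero_of_lt hj, Nat.choose_eq_zero_of_lt (by omega)]
          simp
      push_cast at key ⊢
      linear_combination (f (c + d)) * key

theorem isRationalFraction_of_int {f : ℕ → ℤ} {P Q : Polynomial ℤ} (hQ : Q ≠ 0)
    (h : (Q : PowerSeries ℤ) * PowerSeries.mk f = (P : PowerSeries ℤ)) :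
    IsRationalFraction (PowerSeries.mk fun n => (f n : Polynomial ℤ)) := by
  refine ⟨P.map Polynomial.C, Q.map Polynomial.C,
    (Polynomial.map_ne_zero_iff Polynomial.C_injective).2 hQ, ?_⟩
  have h' := congrArg (PowerSeries.map (Polynomial.C : ℤ →+* Polynomial ℤ)) h
  rw [map_mul, ← Polynomial.polynomial_map_coe, ← Polynomial.polynomial_map_coe] at h'
  rw [← h']
  congr 1

theorem isRationalFraction_segCount_fin {k : ℕ} (τ : Fin k → Bool) :
    IsRationalFraction (PowerSeries.mk fun n => (segCount τ n : Polynomial ℤ)) := by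
  have := isRationalFraction_of_int (charpolyRev_ne_zero _) (charpolyRev_mul_mk_segCount τ)
  simpa using this

end Rational

/-! ### Segmentations with prescribed nonempty segments. -/

section Support

variable {n : ℕ} {ι : Type*} [LinearOrder ι] [Fintype ι]

open Classical in
/-- The number of typed segmentations whose set of nonempty segments is `J`. -/
noncomputable def segCountOn (τ : ι → Bool) (J : Finset ι) (n : ℕ) : ℕ :=
  (Finset.univ.filter fun p : Equiv.Perm (Fin n) × (Fin n → ι) =>
    IsTypedSegmentation τ p ∧ Finset.univ.image p.2 = J).card

omit [Fintype ι] in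
theorem isTypedSegmentation_comp_iff {κ : Type*} [LinearOrder κ] (τ : ι → Bool) (e : κ ↪o ι)
    (π : Equiv.Perm (Fin n)) (seg : Fin n → κ) :
    IsTypedSegmentation τ (π, e ∘ seg) ↔ IsTypedSegmentation (τ ∘ e) (π, seg) := by
  constructor
  · rintro ⟨h1, h2, h3, h4⟩
    exact ⟨fun i j hij => e.le_iff_le.1 (h1 hij), fun i j hij hs => h2 i j hij (congrArg e hs),
      h3, h4⟩
  · rintro ⟨h1, h2, h3, h4⟩
    exact ⟨fun i j hij => e.le_iff_le.2 (h1 hij), fun i j hij hs => h2 i j hij (e.injective hs),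
      h3, h4⟩

theorem sum_powerset_segCountOn (τ : ι → Bool) (J : Finset ι) (n : ℕ) :
    ∑ J' ∈ J.powerset, segCountOn τ J' n = segCount (τ ∘ J.orderEmbOfFin rfl) n := by
  classical
  have h1 : (Finset.univ.filter fun p : Equiv.Perm (Fin n) × (Fin n → ι) =>
      IsTypedSegmentation τ p ∧ Finset.univ.image p.2 ⊆ J).card =
        ∑ J' ∈ J.powerset, segCountOn τ J' n := by
    rw [Finset.card_eq_sum_card_fiberwise (f := fun p => Finset.univ.image p.2) (t := J.powerset)]
    · refine Finset.sum_congr rfl fun J' hJ' => ?_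
      rw [segCountOn, Finset.filter_filter]
      congr 1
      ext p
      simp only [Finset.mem_filter, Finset.mem_univ, true_and]
      constructor
      · rintro ⟨⟨h, _⟩, e⟩
        exact ⟨h, e⟩
      · rintro ⟨h, e⟩
        exact ⟨⟨h, e ▸ Finset.mem_powerset.1 hJ'⟩, e⟩
    · intro p hp
      exact Finset.mem_coe.2 (Finset.mem_powerset.2 (Finset.mem_filter.1 hp).2.2)
  rw [← h1, segCount]
  symm
  refine Finset.card_bij (fun p _ => (p.1, J.orderEmbOfFin rfl ∘ p.2)) ?_ ?_ ?_
  · intro p hp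
    rw [Finset.mem_filter] at hp ⊢
    refine ⟨Finset.mem_univ _, (isTypedSegmentation_comp_iff _ _ _ _).2 hp.2, ?_⟩
    intro x hx
    obtain ⟨i, _, rfl⟩ := Finset.mem_image.1 hx
    exact J.orderEmbOfFin_mem rfl _
  · rintro ⟨π, s⟩ _ ⟨π', s'⟩ _ h
    rw [Prod.mk.injEq] at h
    exact Prod.ext h.1 ((J.orderEmbOfFin rfl).injective.comp_left h.2)
  · rintro ⟨π, s⟩ hp
    rw [Finset.mem_filter] at hp
    have : ∀ i, ∃ j, J.orderEmbOfFin rfl j = s i := fun i => by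
      have : s i ∈ Set.range (J.orderEmbOfFin rfl) := by
        rw [Finset.range_orderEmbOfFin]
        exact hp.2.2 (Finset.mem_image_of_mem _ (Finset.mem_univ i))
      exact this
    choose s' hs' using this
    obtain rfl : J.orderEmbOfFin rfl ∘ s' = s := funext hs'
    exact ⟨(π, s'), Finset.mem_filter.2 ⟨Finset.mem_univ _,
      (isTypedSegmentation_comp_iff _ _ _ _).1 hp.2.1⟩, rfl⟩

/-- Segmentations supported inside `J` have a rational series; those supported on a proper subset
are removed by induction. -/
theorem isRationalFraction_segCountOn (τ : ι → Bool) (J : Finset ι) :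
    IsRationalFraction (PowerSeries.mk fun n => (segCountOn τ J n : Polynomial ℤ)) := by
  induction J using Finset.strongInduction with
  | H J ih =>
    convert (isRationalFraction_segCount_fin (τ ∘ J.orderEmbOfFin rfl)).sub
      (isRationalFraction_sum J.ssubsets _ fun J' hJ' => ih J' (Finset.mem_ssubsets.1 hJ')) using 1
    ext1 n
    rw [map_sub, map_sum]
    simp only [PowerSeries.coeff_mk]
    rw [← sum_powerset_segCountOn, eq_sub_iff_add_eq, Finset.ssubsets, ← Nat.cast_sum,
      ← Nat.cast_add, Finset.add_sum_erase _ (fun J' => segCountOn τ J' n) (Finset.mem_powerset_self J)]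

end Support

/-! ### Derangements cut into increasing runs. -/

/-- `r` cuts the positions into `M` nonempty consecutive parts on which `π` is increasing. -/
structure IsRunMap {n M : ℕ} (π : Equiv.Perm (Fin n)) (r : Fin n → Fin M) : Prop where
  mono : Monotone r
  surj : Function.Surjective r
  inc : ∀ i j, i < j → r i = r j → π i < π j

/-- The excess π(i) - i is weakly increasing on a run, because integer values rise by at least 1 per
step. Hence, for a derangement, the downward positions of a run precede its upward ones, in
accordance with `false < true`. -/
theorem IsRunMap.add_le {n M : ℕ} {π : Equiv.Perm (Fin n)} {r : Fin n → Fin M}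
    (h : IsRunMap π r) {i j : Fin n} (hij : i ≤ j) (hr : r i = r j) :
    (j : ℕ) + π i ≤ i + π j := by
  obtain ⟨d, hd⟩ := Nat.exists_eq_add_of_le (Fin.le_def.1 hij)
  induction d generalizing j with
  | zero =>
    obtain rfl : j = i := Fin.ext hd
    exact le_rfl
  | succ d ih =>
    let j' : Fin n := ⟨i + d, by have := j.2; omega⟩
    have hj' : j' < j := by simp only [j', Fin.lt_def]; omega
    have hij' : i ≤ j' := by simp only [j', Fin.le_def]; omega
    have e : r i = r j' := le_antisymm (h.mono hij') (hr ▸ h.mono hj'.le)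
    have h1 := ih hij' e rfl
    have h2 := h.inc j' j hj' (e.symm.trans hr)
    simp only [j', Fin.lt_def] at *
    omega

open Classical in
/-- The generating polynomial of the crossing descents over the derangements whose positions are
cut into `M` parts on which they are increasing. -/
noncomputable def runXdesPoly (M n : ℕ) : Polynomial ℤ :=
  ∑ p ∈ Finset.univ.filter fun p : Equiv.Perm (Fin n) × (Fin n → Fin M) =>
    p.1 ∈ derangements (Fin n) ∧ IsRunMap p.1 p.2, Polynomial.X ^ xdes p.1

/-- The type of a segment that is labelled by a part and a direction. -/
def lexType {M : ℕ} (x : Fin M ×ₗ Bool) : Bool := (ofLex x).2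

open Classical in
/-- The number of parts that end with an upward segment while the next one starts with a downward
segment, if `J` is the set of nonempty segments. -/
noncomputable def crossings {M : ℕ} (J : Finset (Fin M ×ₗ Bool)) : ℕ :=
  (Finset.univ.filter fun r : Fin M => toLex (r, true) ∈ J ∧
    ∃ h : (r : ℕ) + 1 < M, toLex ((⟨r + 1, h⟩ : Fin M), false) ∈ J).card

section Lex

variable {n M : ℕ} {π : Equiv.Perm (Fin n)}

/-- The segments of a derangement that refine a cutting of the positions. -/
def lexSeg (π : Equiv.Perm (Fin n)) (r : Fin n → Fin M) (i : Fin n) : Fin M ×ₗ Bool :=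
  toLex (r i, decide (i < π i))

theorem IsRunMap.isTypedSegmentation {r : Fin n → Fin M} (h : IsRunMap π r)
    (hπ : π ∈ derangements (Fin n)) : IsTypedSegmentation lexType (π, lexSeg π r) := by
  refine ⟨fun i j hij => ?_, fun i j hij e => ?_, fun i hi => ?_, fun i hi => ?_⟩
  · simp only [lexSeg]
    rw [Prod.Lex.toLex_le_toLex]
    rcases (h.mono hij).lt_or_eq with h1 | h1
    · exact Or.inl h1
    · refine Or.inr ⟨h1, ?_⟩
      have := h.add_le hij h1
      simp only
      rw [Bool.le_iff_imp]
      simp only [decide_eq_true_eq, Fin.lt_def]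
      omega
  · simp only [lexSeg, toLex_inj, Prod.mk.injEq] at e
    exact h.inc i j hij e.1
  · simpa [lexType, lexSeg] using hi
  · simp only [lexType, lexSeg, ofLex_toLex, decide_eq_false_iff_not, not_lt] at hi
    exact lt_of_le_of_ne hi (hπ i)

variable {seg : Fin n → Fin M ×ₗ Bool}

theorem IsTypedSegmentation.mem_derangements
    (h : IsTypedSegmentation lexType (π, seg)) : π ∈ derangements (Fin n) := by
  intro i
  cases hi : lexType (seg i)
  · exact (h.down i hi).ne
  · exact (h.up i hi).ne'

theorem IsTypedSegmentation.lexSeg_eq (h : IsTypedSegmentation lexType (π, seg)) :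
    lexSeg π (fun i => (ofLex (seg i)).1) = seg := by
  ext1 i
  have : decide (i < π i) = (ofLex (seg i)).2 := by
    cases hi : (ofLex (seg i)).2
    · simpa using (h.down i hi).le
    · simpa using h.up i hi
  rw [lexSeg, this]
  rfl

theorem IsTypedSegmentation.isRunMap (h : IsTypedSegmentation lexType (π, seg))
    (hs : Function.Surjective fun i => (ofLex (seg i)).1) :
    IsRunMap π fun i => (ofLex (seg i)).1 := by
  refine ⟨fun i j hij => ?_, hs, fun i j hij e => ?_⟩
  · rcases Prod.Lex.le_iff.1 (h.mono hij) with h1 | h1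
    · exact h1.le
    · exact h1.1.le
  · rcases Prod.Lex.le_iff.1 (h.mono hij.le) with h1 | h1
    · exact absurd e h1.ne
    · rcases h1.2.lt_or_eq with h2 | h2
      -- Across the diagonal inside one run: `π i < i < j < π j`.
      · rw [Bool.lt_iff] at h2
        exact (h.down i h2.1).trans (hij.trans (h.up j h2.2))
      · exact h.inc i j hij (ofLex.injective (Prod.ext e h2))

theorem mem_crossingDescentSet_iff {i : Fin n} : i ∈ crossingDescentSet π ↔
    ∃ h : (i : ℕ) + 1 < n, (i : ℕ) < π i ∧ (π ⟨i + 1, h⟩ : ℕ) ≤ i + 1 := by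
  simp only [crossingDescentSet, descentSet, Finset.mem_filter, Finset.mem_univ, true_and]
  constructor
  · rintro ⟨_, h, h1, h2⟩
    exact ⟨h, h1, h2⟩
  · rintro ⟨h, h1, h2⟩
    refine ⟨⟨h, ?_⟩, h, h1, h2⟩
    have hne : π ⟨i + 1, h⟩ ≠ π i := fun e => by
      have := congrArg Fin.val (π.injective e)
      simp at this
    rw [Fin.lt_def]
    have := Fin.val_ne_of_ne hne
    omega

/-- A crossing descent of a derangement is an upward position followed by a downward one. This
happens only at a boundary of runs, where the last position of one run and the first of the next
have to be compared. -/
theorem xdes_eq_crossings {r : Fin n → Fin M} (h : IsRunMap π r)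
    (hπ : π ∈ derangements (Fin n)) :
    xdes π = crossings (Finset.univ.image (lexSeg π r)) := by
  classical
  -- The two positions cannot share a run, and surjectivity of `r` excludes an empty run between
  -- them.
  have hsucc : ∀ (i : Fin n) (hi : (i : ℕ) + 1 < n), (i : ℕ) < π i →
      (π ⟨i + 1, hi⟩ : ℕ) ≤ i + 1 → (r ⟨i + 1, hi⟩ : ℕ) = r i + 1 := by
    intro i hi h1 h2
    have hlt : i < ⟨i + 1, hi⟩ := by simp [Fin.lt_def]
    have h3 : r i ≠ r ⟨i + 1, hi⟩ := fun e => by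
      have h4 := h.inc _ _ hlt e
      have h5 := Fin.val_ne_of_ne (hπ ⟨i + 1, hi⟩)
      simp only [Fin.lt_def] at h4 h5
      omega
    have h4 := lt_of_le_of_ne (h.mono hlt.le) h3
    by_contra hne
    obtain ⟨j, hj⟩ := h.surj ⟨r i + 1, by have := (r ⟨i + 1, hi⟩).2; rw [Fin.lt_def] at h4; omega⟩
    have hj' := congrArg Fin.val hj
    simp only [Fin.lt_def] at h4 hj'
    rcases le_or_gt j i with hji | hji
    · have := Fin.le_def.1 (h.mono hji)
      omega
    · have hji' : (⟨i + 1, hi⟩ : Fin n) ≤ j := hji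
      have := Fin.le_def.1 (h.mono hji')
      omega
  have hmem : ∀ (c : Fin M) (b : Bool), toLex (c, b) ∈ Finset.univ.image (lexSeg π r) ↔
      ∃ i, r i = c ∧ decide (i < π i) = b := by
    intro c b
    simp [lexSeg, Prod.mk.injEq]
  rw [xdes, crossings]
  refine Finset.card_bij (fun i _ => r i) ?_ ?_ ?_
  · intro i hi
    obtain ⟨hn, h1, h2⟩ := mem_crossingDescentSet_iff.1 hi
    have h3 := hsucc i hn h1 h2
    rw [Finset.mem_filter, hmem]
    refine ⟨Finset.mem_univ _, ⟨i, rfl, by simpa using h1⟩, h3 ▸ (r _).2, ?_⟩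
    rw [hmem]
    exact ⟨⟨i + 1, hn⟩, Fin.ext h3, by simpa [Fin.le_def] using h2⟩
  · have key : ∀ i i' : Fin n, i ∈ crossingDescentSet π → i < i' → r i ≠ r i' := by
      intro i i' hi hlt e
      obtain ⟨hn, h1, h2⟩ := mem_crossingDescentSet_iff.1 hi
      have h3 := hsucc i hn h1 h2
      have hlt' : (⟨i + 1, hn⟩ : Fin n) ≤ i' := hlt
      have := Fin.le_def.1 (h.mono hlt')
      rw [← e] at this
      omega
    intro i hi i' hi' e
    rcases lt_trichotomy i i' with hlt | rfl | hlt
    · exact absurd e (key i i' hi hlt)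
    · rfl
    · exact absurd e.symm (key i' i hi' hlt)
  · intro c hc
    rw [Finset.mem_filter, hmem] at hc
    obtain ⟨_, ⟨j, hj, hjt⟩, hM, hc'⟩ := hc
    rw [hmem] at hc'
    obtain ⟨j', hj', hjt'⟩ := hc'
    -- The descent sought is the last position of run `c`: its excess is positive because some
    -- excess in the run is, and dually for the first position of the next run.
    let F := Finset.univ.filter fun i => r i = c
    have hne : F.Nonempty := ⟨j, by simp [F, hj]⟩
    have hrc : r (F.max' hne) = c := by
      have := F.max'_mem hne
      simpa [F] using this
    set i := F.max' hne
    have hji : j ≤ i := F.le_max' j (by simp [F, hj])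
    have hij' : i < j' := by
      by_contra hle
      have := h.mono (not_lt.1 hle)
      rw [hj', hrc, Fin.le_def] at this
      simp at this
    have hn : (i : ℕ) + 1 < n := by have := j'.2; rw [Fin.lt_def] at hij'; omega
    have hlt : i < ⟨i + 1, hn⟩ := by simp [Fin.lt_def]
    have hle' : (⟨i + 1, hn⟩ : Fin n) ≤ j' := hij'
    have hr1 : r ⟨i + 1, hn⟩ = r j' := by
      refine le_antisymm (h.mono hle') ?_
      rw [hj', Fin.le_def]
      have h1 : r ⟨i + 1, hn⟩ ≠ c := fun e => by
        have := F.le_max' ⟨i + 1, hn⟩ (by simp [F, e])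
        exact absurd hlt (not_lt.2 this)
      have h2 := lt_of_le_of_ne (hrc ▸ h.mono hlt.le) h1.symm
      exact h2
    refine ⟨i, mem_crossingDescentSet_iff.2 ⟨hn, ?_, ?_⟩, hrc⟩
    · have := h.add_le hji (hj.trans hrc.symm)
      simp only [decide_eq_true_eq, Fin.lt_def] at hjt
      omega
    · have := h.add_le hle' hr1
      simp only [decide_eq_false_iff_not, not_lt, Fin.le_def] at hjt'
      simp only at this
      omega

/-- The segmentation refines the runs and determines them, and the exponent is constant for a fixed
set `J` of nonempty segments. -/
theorem runXdesPoly_eq (M n : ℕ) : runXdesPoly M n =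
    ∑ J ∈ Finset.univ.filter (fun J : Finset (Fin M ×ₗ Bool) => ∀ c, ∃ x ∈ J, (ofLex x).1 = c),
      Polynomial.X ^ crossings J * (segCountOn lexType J n : Polynomial ℤ) := by
  classical
  have h1 : ∑ p ∈ Finset.univ.filter (fun p : Equiv.Perm (Fin n) × (Fin n → Fin M ×ₗ Bool) =>
      IsTypedSegmentation lexType p ∧ Function.Surjective fun i => (ofLex (p.2 i)).1),
        (Polynomial.X : Polynomial ℤ) ^ crossings (Finset.univ.image p.2) =
    ∑ J ∈ Finset.univ.filter (fun J : Finset (Fin M ×ₗ Bool) => ∀ c, ∃ x ∈ J, (ofLex x).1 = c),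
      Polynomial.X ^ crossings J * (segCountOn lexType J n : Polynomial ℤ) := by
    rw [← Finset.sum_fiberwise_of_maps_to (g := fun p => Finset.univ.image p.2)
      (t := Finset.univ.filter
        (fun J : Finset (Fin M ×ₗ Bool) => ∀ c, ∃ x ∈ J, (ofLex x).1 = c))]
    · refine Finset.sum_congr rfl fun J hJ => ?_
      rw [Finset.sum_congr rfl (g := fun _ => Polynomial.X ^ crossings J), Finset.sum_const,
        nsmul_eq_mul, mul_comm, segCountOn, Finset.filter_filter]
      · congr 3
        ext p
        simp only [Finset.mem_filter, Finset.mem_univ, true_and]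
        constructor
        · rintro ⟨⟨h, _⟩, e⟩
          exact ⟨h, e⟩
        · rintro ⟨h, e⟩
          refine ⟨⟨h, fun c => ?_⟩, e⟩
          obtain ⟨x, hx, hc⟩ := (Finset.mem_filter.1 hJ).2 c
          rw [← e] at hx
          obtain ⟨i, _, rfl⟩ := Finset.mem_image.1 hx
          exact ⟨i, hc⟩
      · intro p hp
        rw [(Finset.mem_filter.1 hp).2]
    · intro p hp
      rw [Finset.mem_filter] at hp ⊢
      refine ⟨Finset.mem_univ _, fun c => ?_⟩
      obtain ⟨i, hi⟩ := hp.2.2 c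
      exact ⟨p.2 i, Finset.mem_image_of_mem _ (Finset.mem_univ i), hi⟩
  rw [← h1, runXdesPoly]
  refine Finset.sum_bij' (fun p _ => (p.1, lexSeg p.1 p.2))
    (fun p _ => (p.1, fun i => (ofLex (p.2 i)).1)) ?_ ?_ ?_ ?_ ?_
  · intro p hp
    rw [Finset.mem_filter] at hp ⊢
    exact ⟨Finset.mem_univ _, hp.2.2.isTypedSegmentation hp.2.1, hp.2.2.surj⟩
  · intro p hp
    rw [Finset.mem_filter] at hp ⊢
    exact ⟨Finset.mem_univ _, hp.2.1.mem_derangements, hp.2.1.isRunMap hp.2.2⟩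
  · intro p hp
    rfl
  · intro p hp
    rw [Finset.mem_filter] at hp
    exact Prod.ext rfl hp.2.1.lexSeg_eq
  · intro p hp
    rw [Finset.mem_filter] at hp
    rw [xdes_eq_crossings hp.2.2 hp.2.1]

theorem isRationalFraction_runXdesPoly (M : ℕ) :
    IsRationalFraction (PowerSeries.mk (runXdesPoly M)) := by
  convert isRationalFraction_sum (Finset.univ.filter
    (fun J : Finset (Fin M ×ₗ Bool) => ∀ c, ∃ x ∈ J, (ofLex x).1 = c)) _ fun J _ =>
    (isRationalFraction_segCountOn lexType J).C_mul (Polynomial.X ^ crossings J) using 1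
  ext1 n
  rw [map_sum, PowerSeries.coeff_mk, runXdesPoly_eq]
  simp only [PowerSeries.coeff_C_mul, PowerSeries.coeff_mk]

end Lex

/-! ### Run maps as sets of gaps containing the descents. -/

section Jumps

variable {N M : ℕ}

/-- The positions at which a map on `Fin (N + 1)` changes its value. -/
def jumpSet (r : Fin (N + 1) → Fin M) : Finset (Fin N) :=
  Finset.univ.filter fun g => r g.castSucc ≠ r g.succ

theorem val_succ_of_monotone_surjective {r : Fin (N + 1) → Fin M} (hm : Monotone r)
    (hs : Function.Surjective r) (g : Fin N) :
    (r g.succ : ℕ) = r g.castSucc + if g ∈ jumpSet r then 1 else 0 := by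
  simp only [jumpSet, Finset.mem_filter, Finset.mem_univ, true_and]
  split_ifs with h
  · have h1 := lt_of_le_of_ne (hm g.castSucc_lt_succ.le) h
    by_contra hne
    have h2 := (r g.succ).2
    rw [Fin.lt_def] at h1
    obtain ⟨j, hj⟩ := hs ⟨r g.castSucc + 1, by omega⟩
    have hj' := congrArg Fin.val hj
    simp only at hj'
    rcases le_or_gt j g.castSucc with hji | hji
    · have := Fin.le_def.1 (hm hji)
      omega
    · have := Fin.le_def.1 (hm (Fin.castSucc_lt_iff_succ_le.1 hji))
      omega
  · rw [← not_not.1 h, add_zero]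

theorem filter_castSucc_lt_succ (S : Finset (Fin N)) (g : Fin N) :
    (S.filter fun g' => g'.castSucc < g.succ).card =
      (S.filter fun g' => g'.castSucc < g.castSucc).card + if g ∈ S then 1 else 0 := by
  have : (S.filter fun g' => g'.castSucc < g.succ) =
      (S.filter fun g' => g'.castSucc < g.castSucc) ∪ S.filter fun g' => g' = g := by
    ext g'
    simp only [Finset.mem_filter, Finset.mem_union, Fin.lt_def, Fin.val_castSucc, Fin.val_succ,
      Fin.ext_iff]
    rw [← and_or_left]
    refine and_congr_right fun _ => ?_
    omega
  rw [this, Finset.card_union_of_disjoint, Finset.filter_eq']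
  · split_ifs <;> simp
  · rw [Finset.disjoint_filter]
    rintro g' _ h rfl
    exact lt_irrefl _ h

theorem val_eq_card_jumpSet {r : Fin (N + 1) → Fin M} (hm : Monotone r)
    (hs : Function.Surjective r) (i : Fin (N + 1)) :
    (r i : ℕ) = ((jumpSet r).filter fun g => g.castSucc < i).card := by
  induction i using Fin.induction with
  | zero =>
    have hM : 0 < M := (Nat.zero_le _).trans_lt (r 0).2
    obtain ⟨j, hj⟩ := hs ⟨0, hM⟩
    have := Fin.le_def.1 (hm (Fin.zero_le j))
    rw [hj] at this
    simpa using this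
  | succ g ih => rw [val_succ_of_monotone_surjective hm hs, ih, filter_castSucc_lt_succ]

theorem card_jumpSet {r : Fin (N + 1) → Fin (M + 1)} (hm : Monotone r)
    (hs : Function.Surjective r) : (jumpSet r).card = M := by
  have h1 := val_eq_card_jumpSet hm hs (Fin.last N)
  rw [Finset.filter_true_of_mem fun g _ => Fin.castSucc_lt_last g] at h1
  obtain ⟨j, hj⟩ := hs (Fin.last M)
  have h2 := Fin.le_def.1 (hm (Fin.le_last j))
  rw [hj, Fin.val_last] at h2
  have := (r (Fin.last N)).2
  omega

/-- The descents of a permutation, as gaps between consecutive positions. -/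
def descentGaps (π : Equiv.Perm (Fin (N + 1))) : Finset (Fin N) :=
  Finset.univ.filter fun g => π g.succ < π g.castSucc

theorem card_descentGaps (π : Equiv.Perm (Fin (N + 1))) : (descentGaps π).card = des π := by
  rw [des]
  refine Finset.card_bij (fun g _ => g.castSucc) ?_ ?_ ?_
  · intro g hg
    simp only [descentGaps, Finset.mem_filter, Finset.mem_univ, true_and] at hg
    simp only [descentSet, Finset.mem_filter, Finset.mem_univ, true_and]
    exact ⟨by simp, hg⟩
  · intro g _ g' _ h
    exact Fin.castSucc_injective N h
  · intro i hi
    simp only [descentSet, Finset.mem_filter, Finset.mem_univ, true_and] at hi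
    obtain ⟨h, hi⟩ := hi
    refine ⟨⟨i, by omega⟩, ?_, rfl⟩
    simp only [descentGaps, Finset.mem_filter, Finset.mem_univ, true_and]
    exact hi

theorem descentGaps_subset_jumpSet {π : Equiv.Perm (Fin (N + 1))} {r : Fin (N + 1) → Fin M}
    (h : IsRunMap π r) : descentGaps π ⊆ jumpSet r := by
  intro g hg
  simp only [descentGaps, Finset.mem_filter, Finset.mem_univ, true_and] at hg
  simp only [jumpSet, Finset.mem_filter, Finset.mem_univ, true_and]
  exact fun e => lt_asymm hg (h.inc _ _ g.castSucc_lt_succ e)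

-- A run map is determined by its jumps, as its value at `i` is the number of jumps before `i`.
-- Being increasing on the runs means that every descent is a jump.
open Classical in
theorem card_isRunMap (π : Equiv.Perm (Fin (N + 1))) (M : ℕ) :
    (Finset.univ.filter fun r : Fin (N + 1) → Fin (M + 1) => IsRunMap π r).card =
      ((Finset.univ : Finset (Finset (Fin N))).filter
        fun S => descentGaps π ⊆ S ∧ S.card = M).card := by
  refine Finset.card_bij (fun r _ => jumpSet r) ?_ ?_ ?_
  · intro r hr
    rw [Finset.mem_filter] at hr ⊢
    exact ⟨Finset.mem_univ _, descentGaps_subset_jumpSet hr.2, card_jumpSet hr.2.mono hr.2.surj⟩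
  · intro r hr r' hr' e
    rw [Finset.mem_filter] at hr hr'
    funext i
    rw [Fin.ext_iff, val_eq_card_jumpSet hr.2.mono hr.2.surj,
      val_eq_card_jumpSet hr'.2.mono hr'.2.surj, e]
  · intro S hS
    obtain ⟨_, hD, rfl⟩ := Finset.mem_filter.1 hS
    let r : Fin (N + 1) → Fin (S.card + 1) := fun i =>
      ⟨(S.filter fun g => g.castSucc < i).card,
        Nat.lt_succ_of_le (Finset.card_le_card (Finset.filter_subset _ _))⟩
    have hval : ∀ i, (r i : ℕ) = (S.filter fun g => g.castSucc < i).card := fun i => rfl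
    have hstep : ∀ g : Fin N, (r g.succ : ℕ) = r g.castSucc + if g ∈ S then 1 else 0 := fun g =>
      filter_castSucc_lt_succ S g
    have hjump : jumpSet r = S := by
      ext g
      simp only [jumpSet, Finset.mem_filter, Finset.mem_univ, true_and, ne_eq, Fin.ext_iff]
      have := hstep g
      split_ifs at this with h <;> simp [h] <;> omega
    have hm : Monotone r := fun i j hij => by
      rw [Fin.le_def, hval, hval]
      refine Finset.card_le_card fun g hg => ?_
      rw [Finset.mem_filter] at hg ⊢
      exact ⟨hg.1, hg.2.trans_le hij⟩
    have hs : Function.Surjective r := by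
      -- A discrete intermediate value argument: `r` starts at `0` and rises by at most 1.
      have hle : ∀ (i : Fin (N + 1)) (c : ℕ), c ≤ r i → ∃ j, (r j : ℕ) = c := by
        intro i
        induction i using Fin.induction with
        | zero =>
          intro c hc
          refine ⟨0, ?_⟩
          simp only [hval, Fin.not_lt_zero, Finset.filter_false, Finset.card_empty] at hc ⊢
          omega
        | succ g ih =>
          intro c hc
          rcases Nat.lt_or_ge (r g.castSucc) c with h | h
          · refine ⟨g.succ, ?_⟩
            have := hstep g
            split_ifs at this <;> omega
          · exact ih c h
      intro c
      obtain ⟨j, hj⟩ := hle (Fin.last N) c (by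
        rw [hval, Finset.filter_true_of_mem fun g _ => Fin.castSucc_lt_last g]
        exact Nat.lt_succ_iff.1 c.2)
      exact ⟨j, Fin.ext hj⟩
    refine ⟨r, Finset.mem_filter.2 ⟨Finset.mem_univ _, hm, hs, fun i j => ?_⟩, hjump⟩
    induction j using Fin.induction with
    | zero => exact fun h => absurd h (Fin.not_lt_zero i)
    | succ g ih =>
      intro hij e
      have hig : i ≤ g.castSucc := Fin.le_castSucc_iff.2 hij
      have e1 : r i = r g.castSucc := le_antisymm (hm hig) (e ▸ hm g.castSucc_lt_succ.le)
      have hg : g ∉ descentGaps π := fun hg => by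
        have := hD hg
        rw [← hjump] at this
        exact (Finset.mem_filter.1 this).2 (e1.symm.trans e)
      have hlt : π g.castSucc < π g.succ := by
        simp only [descentGaps, Finset.mem_filter, Finset.mem_univ, true_and, not_lt] at hg
        exact lt_of_le_of_ne hg fun e => g.castSucc_lt_succ.ne (π.injective e)
      rcases hig.lt_or_eq with h | rfl
      · exact (ih h e1).trans hlt
      · exact hlt

/-- The part of `S` outside `D` is arbitrary, so the binomial theorem gives a power of x + (1 - x) =
1. -/
theorem sum_pow_card_superset {R : Type*} [CommRing R] (D : Finset (Fin N)) (x : R) :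
    ∑ S ∈ (Finset.univ : Finset (Finset (Fin N))).filter (fun S => D ⊆ S),
      x ^ S.card * (1 - x) ^ (N - S.card) = x ^ D.card := by
  have h : ∑ S ∈ (Finset.univ : Finset (Finset (Fin N))).filter (fun S => D ⊆ S),
      x ^ S.card * (1 - x) ^ (N - S.card) =
      ∑ T ∈ (Finset.univ \ D).powerset, x ^ (D.card + T.card) *
        (1 - x) ^ ((Finset.univ \ D).card - T.card) := by
    refine Finset.sum_bij' (fun S _ => S \ D) (fun T _ => D ∪ T) ?_ ?_ ?_ ?_ ?_
    · intro S _
      exact Finset.mem_powerset.2 (Finset.sdiff_subset_sdiff (Finset.subset_univ S) le_rfl)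
    · intro T _
      exact Finset.mem_filter.2 ⟨Finset.mem_univ _, Finset.subset_union_left⟩
    · intro S hS
      exact Finset.union_sdiff_of_subset (Finset.mem_filter.1 hS).2
    · intro T hT
      refine Finset.union_sdiff_cancel_left (Finset.disjoint_left.2 fun g hg hgT => ?_)
      exact (Finset.mem_sdiff.1 (Finset.mem_powerset.1 hT hgT)).2 hg
    · intro S hS
      have hD := (Finset.mem_filter.1 hS).2
      have h1 := Finset.card_sdiff_add_card_eq_card hD
      have h2 := Finset.card_sdiff_add_card_eq_card (Finset.subset_univ D)
      rw [Finset.card_univ, Fintype.card_fin] at h2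
      congr 2 <;> omega
  rw [h]
  simp only [pow_add, mul_assoc]
  rw [← Finset.mul_sum, Finset.sum_pow_mul_eq_add_pow, add_sub_cancel, one_pow, mul_one]

open Classical in
theorem pow_des_eq_sum {R : Type*} [CommRing R] (π : Equiv.Perm (Fin (N + 1))) (x : R) :
    x ^ des π = ∑ M ∈ Finset.range (N + 1), x ^ M * (1 - x) ^ (N - M) *
      ((Finset.univ.filter fun r : Fin (N + 1) → Fin (M + 1) => IsRunMap π r).card : R) := by
  rw [← card_descentGaps, ← sum_pow_card_superset,
    ← Finset.sum_fiberwise_of_maps_to (g := Finset.card) (t := Finset.range (N + 1))]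
  · refine Finset.sum_congr rfl fun M _ => ?_
    rw [card_isRunMap, Finset.filter_filter, Finset.sum_congr rfl
      (g := fun _ => x ^ M * (1 - x) ^ (N - M)), Finset.sum_const, nsmul_eq_mul, mul_comm]
    intro S hS
    rw [(Finset.mem_filter.1 hS).2.2]
  · intro S _
    rw [Finset.mem_range, Nat.lt_succ_iff]
    simpa using Finset.card_le_univ S

end Jumps

/-! ### Extraction of the coefficient of t^m. -/

theorem desXdesPoly_succ (N : ℕ) : desXdesPoly (N + 1) =
    ∑ M ∈ Finset.range (N + 1), (Polynomial.X : Polynomial (Polynomial ℤ)) ^ M *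
      (1 - Polynomial.X) ^ (N - M) * Polynomial.C (runXdesPoly (M + 1) (N + 1)) := by
  classical
  have h : ∀ M, runXdesPoly (M + 1) (N + 1) = ∑ π : derangements (Fin (N + 1)),
      ((Finset.univ.filter fun r : Fin (N + 1) → Fin (M + 1) => IsRunMap π.1 r).card :
        Polynomial ℤ) * Polynomial.X ^ xdes π.1 := by
    intro M
    rw [runXdesPoly, Finset.sum_filter, Fintype.sum_prod_type,
      ← Finset.sum_subtype (Finset.univ.filter fun π => π ∈ derangements (Fin (N + 1)))
        (fun π => by simp) (fun π => ((Finset.univ.filter fun r : Fin (N + 1) → Fin (M + 1) =>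
          IsRunMap π r).card : Polynomial ℤ) * Polynomial.X ^ xdes π), Finset.sum_filter]
    refine Finset.sum_congr rfl fun π _ => ?_
    split_ifs with hπ
    · simp only [hπ, true_and]
      rw [← Finset.sum_filter, Finset.sum_const, nsmul_eq_mul]
    · simp [hπ]
  simp only [desXdesPoly, h, map_sum, Finset.mul_sum]
  rw [Finset.sum_comm]
  refine Finset.sum_congr rfl fun π _ => ?_
  rw [pow_des_eq_sum, Finset.sum_mul]
  refine Finset.sum_congr rfl fun M _ => ?_
  rw [map_mul, map_natCast, mul_assoc]

theorem coeff_one_sub_X_pow {R : Type*} [CommRing R] (p j : ℕ) :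
    ((1 - Polynomial.X : Polynomial R) ^ p).coeff j = (-1) ^ j * (p.choose j : R) := by
  have : (1 - Polynomial.X : Polynomial R) = (1 + Polynomial.X).comp (-Polynomial.X) := by
    simp [sub_eq_add_neg]
  rw [this, ← Polynomial.pow_comp, ← neg_one_mul, ← map_one Polynomial.C, ← map_neg,
    Polynomial.comp_C_mul_X_coeff, map_one, Polynomial.coeff_one_add_X_pow, mul_comm]

theorem runXdesPoly_eq_zero {M n : ℕ} (h : n < M) : runXdesPoly M n = 0 := by
  classical
  rw [runXdesPoly]
  refine Finset.sum_eq_zero ?_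
  intro p hp
  have := Fintype.card_le_of_surjective _ (Finset.mem_filter.1 hp).2.2.surj
  simp only [Fintype.card_fin] at this
  omega

/-- The range of summation no longer depends on `N`. The difference N - M is written as n - (M + 1)
to match `IsRationalFraction.choose_mul` with `c = M + 1`. -/
theorem coeff_desXdesPoly_succ (N m : ℕ) : (desXdesPoly (N + 1)).coeff m =
    ∑ M ∈ Finset.range (m + 1), (-1) ^ (m - M) *
      (((N + 1 - (M + 1)).choose (m - M) : Polynomial ℤ) * runXdesPoly (M + 1) (N + 1)) := by
  have hterm : ∀ M, ((Polynomial.X : Polynomial (Polynomial ℤ)) ^ M *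
      (1 - Polynomial.X) ^ (N - M) * Polynomial.C (runXdesPoly (M + 1) (N + 1))).coeff m =
      if M ≤ m then (-1) ^ (m - M) *
        (((N + 1 - (M + 1)).choose (m - M) : Polynomial ℤ) * runXdesPoly (M + 1) (N + 1))
      else 0 := by
    intro M
    rw [Polynomial.coeff_mul_C, Polynomial.coeff_X_pow_mul', coeff_one_sub_X_pow]
    split_ifs
    · rw [Nat.add_sub_add_right, mul_assoc]
    · rw [zero_mul]
  rw [desXdesPoly_succ, Polynomial.finsetSum_coeff]
  simp only [hterm]
  rw [← Finset.sum_filter]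
  -- The added indices have M > N: more runs than positions.
  refine Finset.sum_subset (fun M hM => ?_) fun M hM hM' => ?_
  · rw [Finset.mem_filter] at hM
    rw [Finset.mem_range]
    omega
  · rw [Finset.mem_filter, Finset.mem_range] at hM'
    rw [Finset.mem_range] at hM
    rw [runXdesPoly_eq_zero (by omega), mul_zero, mul_zero]

theorem desXdesPoly_one : desXdesPoly 1 = 0 := by
  rw [desXdesPoly]
  refine Finset.sum_eq_zero fun π _ => ?_
  exact absurd (Subsingleton.elim _ _) (π.2 0)

theorem mainTheorem6 (m : ℕ) : IsRationalFraction (coeffT m derangementGF) := by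
  have hconst : IsRationalFraction (PowerSeries.C ((1 : Polynomial (Polynomial ℤ)).coeff m)) := by
    simpa using isRationalFraction_coe (Polynomial.C ((1 : Polynomial (Polynomial ℤ)).coeff m))
  convert hconst.add (isRationalFraction_sum (Finset.range (m + 1)) _ fun M _ =>
    ((isRationalFraction_runXdesPoly (M + 1)).choose_mul (c := M + 1)
      (fun n hn => runXdesPoly_eq_zero hn) (m - M)).C_mul ((-1) ^ (m - M))) using 1
  ext1 n
  rw [coeffT, PowerSeries.coeff_mk, derangementGF, map_add, map_add,
    PowerSeries.coeff_mk, Polynomial.coeff_add]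
  simp only [map_sum, PowerSeries.coeff_C_mul, PowerSeries.coeff_mk]
  rcases n with _ | N
  · simp only [PowerSeries.coeff_zero_one, PowerSeries.coeff_zero_C]
    rw [Finset.sum_eq_zero fun M _ => by rw [runXdesPoly_eq_zero (Nat.succ_pos M)]; simp]
    simp
  · have h1 : (PowerSeries.coeff (N + 1)) (1 : PowerSeries (Polynomial (Polynomial ℤ))) = 0 := by
      simp [PowerSeries.coeff_one]
    -- The cutoff at 2 loses nothing, since one point has no derangement.
    have h2 : (if 2 ≤ N + 1 then desXdesPoly (N + 1) else 0) = desXdesPoly (N + 1) := by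
      split_ifs with h
      · rfl
      · obtain rfl : N = 0 := by omega
        exact desXdesPoly_one.symm
    rw [h1, h2, coeff_desXdesPoly_succ, PowerSeries.coeff_C, if_neg N.succ_ne_zero,
      Polynomial.coeff_zero]
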